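/- Let $E$ be a (real) Banach lattice and let $W\subseteq E$ be relatively weakly compact. Let $\mathrm{sol}(W)=\{y\in E : |y|\le |x| \text{ for some } x\in W\}$ be the solid hull of $W$. Call a sequence $(x_n)$ in $E$ uaw-null (unbounded absolutely weakly convergent to zero) if, for every $u\in E$ with $u\ge 0$, the sequence $(|x_n|\wedge u)_n$ converges weakly to $0$. Then every uaw-null sequence $(x_n)$ contained in $\mathrm{sol}(W)$ converges weakly to $0$ in $E$. -/

import Mathlib

open Filter Topology

section BanachLattice

variable {E : Type*} [NormedAddCommGroup E] [NormedSpace ℝ E]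

/-- Convergence of the family `x` to `a` along the filter `l` in the weak topology `σ(E, E')`. -/
def WeakTendsto {ι : Type*} (x : ι → E) (l : Filter ι) (a : E) : Prop :=
  Tendsto (fun i => toWeakSpace ℝ E (x i)) l (𝓝 (toWeakSpace ℝ E a))

/-- `W` is relatively weakly compact: its closure in the weak topology is weakly compact. -/
def IsRelativelyWeaklyCompact (W : Set E) : Prop :=
  IsCompact (closure (toWeakSpace ℝ E '' W))

/-- Unbounded absolutely weak convergence of `x` to `a` along `l`: for every `u ≥ 0`,
the family `|x i - a| ⊓ u` converges weakly to `0`. -/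
def UawTendsto [Lattice E] {ι : Type*} (x : ι → E) (l : Filter ι) (a : E) : Prop :=
  ∀ u : E, 0 ≤ u → WeakTendsto (fun i => |x i - a| ⊓ u) l 0

end BanachLattice

/-! ### Weak compactness and a gliding hump in `ℓ¹`. -/

section WeakTopology

variable {E : Type*} [NormedAddCommGroup E] [NormedSpace ℝ E]

/-! It suffices to show `f |x n| → 0` for positive `f`, as such functionals span the dual.
Otherwise, being uaw-null yields for each `u ≥ 0` some `n` with `f |x n| ≥ ε` while `f (|x n| ⊓ u)`
is small. `exists_disjoint_sequence` then extracts disjoint `v k`, dominated by `|w k|` with `w k ∈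
W`, such that `f (v k) ≥ ε / 2`. The functionals of `exists_functionals_of_disjoint` form a bounded
operator `y ↦ (g k y)` into `ℓ¹` with `g k (w k) ≥ ε / 2`. This is impossible: by a Schur-type
argument, `tendsto_apply_zero_of_sum_abs_le`, weak compactness of the closure of `W` forces `g k (w
k) → 0`. -/

theorem weakTendsto_iff_forall_apply {ι : Type*} {x : ι → E} {l : Filter ι} {a : E} :
    WeakTendsto x l a ↔ ∀ h : E →L[ℝ] ℝ, Tendsto (fun i => h (x i)) l (𝓝 (h a)) := by
  have hB : Function.Injective (topDualPairing ℝ E).flip := fun a b hab =>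
    (SeparatingDual.eq_iff_forall_dual_eq (R := ℝ)).2 fun h => LinearMap.congr_fun hab h
  exact WeakBilin.tendsto_iff_forall_eval_tendsto (topDualPairing ℝ E).flip hB

/-- Ultrafilter limits stand in for weakly convergent subsequences, which avoids Eberlein–Šmulian.
-/
theorem IsRelativelyWeaklyCompact.exists_weakTendsto_ultrafilter {W : Set E}
    (hW : IsRelativelyWeaklyCompact W) {ι : Type*} {w : ι → E} (hw : ∀ i, w i ∈ W)
    (U : Ultrafilter ι) : ∃ a : E, WeakTendsto w U a := by
  obtain ⟨a, -, ha⟩ := hW.ultrafilter_le_nhds (U.map fun i => toWeakSpace ℝ E (w i)) <| by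
    rw [le_principal_iff]
    exact Filter.mem_map.2 (Filter.univ_mem' fun i =>
      subset_closure (Set.mem_image_of_mem _ (hw i)))
  exact ⟨(toWeakSpace ℝ E).symm a, ha⟩

theorem IsRelativelyWeaklyCompact.exists_norm_le {W : Set E}
    (hW : IsRelativelyWeaklyCompact W) : ∃ M, ∀ w ∈ W, ‖w‖ ≤ M := by
  obtain ⟨M, hM⟩ := banach_steinhaus
    (g := fun w : W => NormedSpace.inclusionInDoubleDual ℝ E w) fun h => by
      have hc : Continuous fun y : WeakSpace ℝ E => h ((toWeakSpace ℝ E).symm y) :=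
        WeakBilin.eval_continuous (topDualPairing ℝ E).flip h
      obtain ⟨C, hC⟩ := (hW.image hc).isBounded.exists_norm_le
      exact ⟨C, fun w => hC _ ⟨_, subset_closure (Set.mem_image_of_mem _ w.2), rfl⟩⟩
  refine ⟨M, fun w hw => ?_⟩
  have := hM ⟨w, hw⟩
  rwa [show ‖NormedSpace.inclusionInDoubleDual ℝ E w‖ = ‖w‖ from
    (NormedSpace.inclusionInDoubleDualLi ℝ).norm_map w] at this

/-- If the partial sums `∑ |g k x|` are bounded by `C * ‖x‖`, then `∑ g k` defines a bounded
functional. -/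
theorem exists_hasSum_apply_of_sum_abs_le {g : ℕ → E →L[ℝ] ℝ} {C : ℝ}
    (hg : ∀ x (s : Finset ℕ), ∑ k ∈ s, |g k x| ≤ C * ‖x‖) :
    ∃ G : E →L[ℝ] ℝ, ∀ x, HasSum (fun k => g k x) (G x) := by
  have hs : ∀ x, Summable fun k => g k x := fun x =>
    (summable_of_sum_le (fun _ => abs_nonneg _) (hg x)).of_abs
  refine ⟨LinearMap.mkContinuous
    { toFun := fun x => ∑' k, g k x
      map_add' := fun x y => by simp only [map_add]; exact (hs x).tsum_add (hs y)
      map_smul' := fun c x => by simp [tsum_mul_left] } C fun x => ?_, fun x => (hs x).hasSum⟩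
  refine le_of_tendsto (hs x).hasSum.norm (Eventually.of_forall fun s => ?_)
  exact (Finset.abs_sum_le_sum_abs _ _).trans (hg x s)

/-- Gliding hump: an operator `x ↦ (g n x)` into `ℓ¹` maps a relatively weakly compact set to a
set whose coordinates are uniformly small at infinity. -/
theorem IsRelativelyWeaklyCompact.tendsto_apply_zero_of_sum_abs_le {W : Set E}
    (hW : IsRelativelyWeaklyCompact W) {g : ℕ → E →L[ℝ] ℝ} {C : ℝ}
    (hg : ∀ x (s : Finset ℕ), ∑ k ∈ s, |g k x| ≤ C * ‖x‖) {w : ℕ → E} (hw : ∀ n, w n ∈ W) :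
    Tendsto (fun n => g n (w n)) atTop (𝓝 0) := by
  have hsum : ∀ x, Summable fun k => |g k x| := fun x =>
    summable_of_sum_le (fun _ => abs_nonneg _) (hg x)
  by_contra hcon
  obtain ⟨δ, hδ, hfr⟩ : ∃ δ > 0, ∃ᶠ n in atTop, δ ≤ |g n (w n)| := by
    simpa [Metric.tendsto_nhds, Filter.Frequently] using hcon
  obtain ⟨U, hU, hUδ⟩ : ∃ U : Ultrafilter ℕ, (U : Filter ℕ) ≤ atTop ∧
      ∀ᶠ n in U, δ ≤ |g n (w n)| := by
    have : NeBot (atTop ⊓ 𝓟 {n | δ ≤ |g n (w n)|}) := frequently_mem_iff_neBot.1 hfr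
    exact ⟨_, (Ultrafilter.of_le _).trans inf_le_left,
      le_principal_iff.1 ((Ultrafilter.of_le _).trans inf_le_right)⟩
  obtain ⟨a, ha⟩ := hW.exists_weakTendsto_ultrafilter hw U
  rw [weakTendsto_iff_forall_apply] at ha
  set z : ℕ → E := fun n => w n - a with hz
  have hz0 : ∀ h : E →L[ℝ] ℝ, Tendsto (fun n => |h (z n)|) U (𝓝 0) := fun h => by
    simpa [hz] using ((ha h).sub_const (h a)).abs
  have hga : Tendsto (fun n => |g n a|) atTop (𝓝 0) := (hsum a).tendsto_atTop_zero
  -- The budget: a hump of `8η = δ / 2`, at most `2η` before it and `η` after it, leaves `5η`,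
  -- against an upper bound of `2η` in the limit.
  set η : ℝ := δ / 16 with hη
  have hη0 : 0 < η := by positivity
  have hlarge : ∀ᶠ n in U, 8 * η ≤ |g n (z n)| := by
    filter_upwards [hUδ, hU (hga.eventually (gt_mem_nhds (show (0 : ℝ) < 8 * η by positivity)))]
      with n h1 h2
    have := abs_sub_abs_le_abs_sub (g n (w n)) (g n a)
    simp only [hz, map_sub]
    linarith
  have htail : ∀ m, ∀ᶠ n in atTop, ∀ s : Finset ℕ, (∀ k ∈ s, n ≤ k) →
      ∑ k ∈ s, |g k (z m)| ≤ η := fun m => by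
    obtain ⟨s₀, hs₀⟩ := summable_iff_vanishing_norm.1 (hsum (z m)) η hη0
    obtain ⟨N, hN⟩ := s₀.exists_nat_subset_range
    filter_upwards [eventually_ge_atTop N] with n hn s hs
    refine (le_abs_self _).trans (hs₀ s ?_).le
    refine Finset.disjoint_left.2 fun k hk hk' => ?_
    have := Finset.mem_range.1 (hN hk')
    have := hs k hk
    omega
  obtain ⟨φ, hφP, hφ⟩ := exists_seq_of_forall_finset_exists (fun n => 8 * η ≤ |g n (z n)|)
    (fun m n => m < n ∧ |g m (z n)| ≤ η * (1 / 2) ^ m ∧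
      ∀ s : Finset ℕ, (∀ k ∈ s, n ≤ k) → ∑ k ∈ s, |g k (z m)| ≤ η) fun s _ => by
    have hev : ∀ᶠ n in U, 8 * η ≤ |g n (z n)| ∧ ∀ m ∈ s, (m < n ∧ |g m (z n)| ≤ η * (1 / 2) ^ m ∧
        ∀ s : Finset ℕ, (∀ k ∈ s, n ≤ k) → ∑ k ∈ s, |g k (z m)| ≤ η) := by
      refine hlarge.and ((Filter.eventually_all_finset s).2 fun m _ => ?_)
      refine ((eventually_gt_atTop m).filter_mono hU).and
        (Eventually.and ?_ ((htail m).filter_mono hU))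
      exact (hz0 (g m)).eventually (ge_mem_nhds (by positivity))
    exact hev.exists
  have hmono : StrictMono φ := fun m n hmn => (hφ m n hmn).1
  have hgeom : ∀ s : Finset ℕ, ∑ k ∈ s, η * (1 / 2) ^ (φ k) ≤ 2 * η := fun s => by
    rw [← Finset.mul_sum, mul_comm 2]
    refine mul_le_mul_of_nonneg_left ?_ hη0.le
    calc ∑ k ∈ s, (1 / 2 : ℝ) ^ (φ k) ≤ ∑ k ∈ s, (1 / 2 : ℝ) ^ k :=
          Finset.sum_le_sum fun k _ =>
            pow_le_pow_of_le_one (by norm_num) (by norm_num) (hmono.id_le k)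
      _ ≤ ∑' k : ℕ, (1 / 2 : ℝ) ^ k := summable_geometric_two.sum_le_tsum s
          fun k _ => by positivity
      _ = 2 := tsum_geometric_two
  obtain ⟨G, hG⟩ := exists_hasSum_apply_of_sum_abs_le (g := fun k => g (φ k)) (C := C)
    fun x s => by simpa using hg x (s.map ⟨φ, hmono.injective⟩)
  -- The limit `b` along the subsequence may differ from `a`, but each `g (φ k)` is still tiny at `b
  -- - a`.
  obtain ⟨b, hb⟩ := hW.exists_weakTendsto_ultrafilter (fun j => hw (φ j)) (hyperfilter ℕ)
  rw [weakTendsto_iff_forall_apply] at hb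
  have hzb : ∀ h : E →L[ℝ] ℝ, Tendsto (fun j => |h (z (φ j))|) (hyperfilter ℕ)
      (𝓝 |h (b - a)|) := fun h => by
    simpa [hz] using ((hb h).sub_const (h a)).abs
  have hatTop : (hyperfilter ℕ : Filter ℕ) ≤ atTop := Nat.hyperfilter_le_atTop
  have hsmall : |G (b - a)| ≤ 2 * η := by
    refine le_of_tendsto (hG (b - a)).norm (Eventually.of_forall fun s => ?_)
    refine (Finset.abs_sum_le_sum_abs _ _).trans
      ((Finset.sum_le_sum fun k _ => ?_).trans (hgeom s))
    refine le_of_tendsto (hzb (g (φ k))) (hatTop ?_)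
    filter_upwards [eventually_gt_atTop k] with j hj using (hφ k j hj).2.1
  have hbig : ∀ j, 5 * η ≤ |G (z (φ j))| := fun j => by
    have h1 : ∀ N, j < N → 5 * η ≤ |∑ k ∈ Finset.range N, g (φ k) (z (φ j))| := fun N hN => by
      obtain ⟨d, rfl⟩ : ∃ d, N = j + 1 + d := ⟨N - (j + 1), by omega⟩
      rw [Finset.sum_range_add, Finset.sum_range_succ]
      have h2 : |∑ k ∈ Finset.range j, g (φ k) (z (φ j))| ≤ 2 * η :=
        (Finset.abs_sum_le_sum_abs _ _).trans ((Finset.sum_le_sum fun k hk =>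
          (hφ k j (Finset.mem_range.1 hk)).2.1).trans (hgeom _))
      have h3 : |∑ k ∈ Finset.range d, g (φ (j + 1 + k)) (z (φ j))| ≤ η := by
        refine (Finset.abs_sum_le_sum_abs _ _).trans ?_
        have := (hφ j (j + 1) (Nat.lt_succ_self j)).2.2
          ((Finset.range d).map ⟨fun k => φ (j + 1 + k), fun k l hkl => by
            simpa using hmono.injective hkl⟩) fun k hk => by
              obtain ⟨i, -, rfl⟩ := Finset.mem_map.1 hk
              exact hmono.monotone (Nat.le_add_right _ _)
        rwa [Finset.sum_map] at this
      have h4 := hφP j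
      grind
    refine ge_of_tendsto (hG (z (φ j))).tendsto_sum_nat.abs ?_
    filter_upwards [eventually_gt_atTop j] with N hN using h1 N hN
  have := ge_of_tendsto (hzb G) (Eventually.of_forall hbig)
  linarith

end WeakTopology

/-! ### Supporting functionals. -/

section HahnBanach

/-- Every point admits a supporting functional of a given sublinear functional. -/
theorem exists_linearMap_le_sublinear_apply_eq {V : Type*} [AddCommGroup V] [Module ℝ V]
    {p : V → ℝ} (p_hom : ∀ c : ℝ, 0 < c → ∀ x, p (c • x) = c * p x)
    (p_add : ∀ x y, p (x + y) ≤ p x + p y) (w : V) :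
    ∃ g : V →ₗ[ℝ] ℝ, g w = p w ∧ ∀ x, g x ≤ p x := by
  have p_zero : p 0 = 0 := by
    have := p_hom 2 (by norm_num) 0
    rw [smul_zero] at this
    linarith
  have H : ∀ c : ℝ, c • w = 0 → (RingHom.id ℝ) c • p w = 0 := fun c hc => by
    rcases smul_eq_zero.1 hc with rfl | rfl <;> simp [p_zero]
  obtain ⟨g, hg, hgp⟩ := exists_extension_of_le_sublinear
    (LinearPMap.mkSpanSingleton' (σ := RingHom.id ℝ) w (p w) H) p p_hom p_add (by
      rintro ⟨x, hx⟩
      obtain ⟨c, rfl⟩ := Submodule.mem_span_singleton.1 hx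
      rw [LinearPMap.mkSpanSingleton'_apply]
      rcases lt_trichotomy c 0 with hc | rfl | hc
      -- For `c < 0`, subadditivity at `c • w` and `-c • w` gives `c * p w ≤ p (c • w)`.
      · have h1 := p_hom (-c) (neg_pos.2 hc) w
        have h2 := p_add (c • w) ((-c) • w)
        rw [← add_smul, add_neg_cancel, zero_smul, p_zero] at h2
        simp only [RingHom.id_apply, smul_eq_mul]
        linarith
      · simp [p_zero]
      · simp [p_hom c hc])
  refine ⟨g, ?_, hgp⟩
  exact (hg ⟨w, Submodule.mem_span_singleton_self w⟩).trans
    (LinearPMap.mkSpanSingleton'_apply_self w (p w) H _)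

end HahnBanach

/-! ### Disjointness and infima in lattice ordered groups. -/

section LatticeGroup

variable {E : Type*} [AddCommGroup E] [Lattice E] [IsOrderedAddMonoid E]

theorem posPart_add_le (a b : E) : (a + b)⁺ ≤ a⁺ + b⁺ :=
  sup_le (add_le_add (le_posPart a) (le_posPart b))
    (add_nonneg (posPart_nonneg a) (posPart_nonneg b))

/-- In a lattice ordered group, infima with a fixed element are subadditive on the positive cone. -/
theorem inf_add_le_inf_add_inf {a b c : E} (ha : 0 ≤ a) (hb : 0 ≤ b) (hc : 0 ≤ c) :
    (a + b) ⊓ c ≤ a ⊓ c + b ⊓ c := by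
  rw [add_inf, inf_add, inf_add]
  refine le_inf (le_inf inf_le_left (inf_le_right.trans (le_add_of_nonneg_right hb)))
    (le_inf (inf_le_right.trans (le_add_of_nonneg_left ha))
      (inf_le_right.trans (le_add_of_nonneg_left hc)))

/-- A disjoint sum is a supremum; the induction also carries disjointness of the partial sum from
the remaining terms. -/
theorem sum_le_of_pairwise_inf_eq_zero {ι : Type*} {s : Finset ι} {a : ι → E} {b : E}
    (ha : ∀ i, 0 ≤ a i) (hb : 0 ≤ b) (hab : ∀ i, a i ≤ b)
    (hdis : ∀ i j, i ≠ j → a i ⊓ a j = 0) : ∑ i ∈ s, a i ≤ b := by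
  classical
  suffices h : ∑ i ∈ s, a i ≤ b ∧ ∀ j ∉ s, (∑ i ∈ s, a i) ⊓ a j = 0 from h.1
  induction s using Finset.induction_on with
  | empty => exact ⟨by simpa using hb, fun j _ => by simpa using ha j⟩
  | insert k s hk ih =>
    rw [Finset.sum_insert hk]
    refine ⟨?_, fun j hj => ?_⟩
    · rw [← inf_add_sup, inf_comm, ih.2 k hk, zero_add]
      exact sup_le (hab k) ih.1
    · rw [Finset.mem_insert, not_or] at hj
      refine le_antisymm ?_ (le_inf (add_nonneg (ha k) (Finset.sum_nonneg fun i _ => ha i)) (ha j))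
      refine (inf_add_le_inf_add_inf (ha k) (Finset.sum_nonneg fun i _ => ha i) (ha j)).trans ?_
      rw [hdis k j (Ne.symm hj.1), ih.2 j hj.2, zero_add]

end LatticeGroup

theorem norm_le_norm_of_nonneg_of_le {E : Type*} [NormedAddCommGroup E] [Lattice E]
    [IsOrderedAddMonoid E] [HasSolidNorm E] {a b : E} (ha : 0 ≤ a) (hab : a ≤ b) : ‖a‖ ≤ ‖b‖ :=
  norm_le_norm_of_abs_le_abs (by rwa [abs_of_nonneg ha, abs_of_nonneg (ha.trans hab)])

section PositiveFunctional

variable {E : Type*} [NormedAddCommGroup E] [NormedSpace ℝ E] [Lattice E]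
  [IsOrderedAddMonoid E]

theorem ContinuousLinearMap.monotone_of_nonneg {f : E →L[ℝ] ℝ} (hf : ∀ x, 0 ≤ x → 0 ≤ f x) :
    Monotone f := fun a b hab => by
  have := hf (b - a) (sub_nonneg.2 hab)
  rw [map_sub] at this
  linarith

theorem abs_apply_le_apply_abs {f : E →L[ℝ] ℝ} (hf : ∀ x, 0 ≤ x → 0 ≤ f x) (x : E) :
    |f x| ≤ f |x| := by
  have hmono := ContinuousLinearMap.monotone_of_nonneg hf
  have := hmono (neg_le_abs x)
  rw [map_neg] at this
  exact abs_le.2 ⟨by linarith, hmono (le_abs_self x)⟩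

end PositiveFunctional

/-! ### Positive functionals and disjoint sequences in normed lattices. -/

section NormedLattice

variable {E : Type*} [NormedAddCommGroup E] [NormedSpace ℝ E] [Lattice E]

variable [IsOrderedModule ℝ E]

theorem smul_inf_of_nonneg {c : ℝ} (hc : 0 ≤ c) (a b : E) : c • (a ⊓ b) = c • a ⊓ c • b := by
  rcases hc.eq_or_lt with rfl | hc
  · simp
  refine le_antisymm (le_inf (smul_le_smul_of_nonneg_left inf_le_left hc.le)
    (smul_le_smul_of_nonneg_left inf_le_right hc.le)) ?_
  rw [← inv_smul_le_iff_of_pos hc]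
  refine le_inf ?_ ?_ <;> rw [inv_smul_le_iff_of_pos hc]
  exacts [inf_le_left, inf_le_right]

variable [IsOrderedAddMonoid E]

theorem smul_sup_of_nonneg {c : ℝ} (hc : 0 ≤ c) (a b : E) : c • (a ⊔ b) = c • a ⊔ c • b := by
  have := smul_inf_of_nonneg hc (-a) (-b)
  rw [← neg_sup, smul_neg, smul_neg, smul_neg, ← neg_sup] at this
  exact neg_injective this

theorem posPart_smul_of_nonneg {c : ℝ} (hc : 0 ≤ c) (a : E) : (c • a)⁺ = c • a⁺ := by
  simp [posPart_def, smul_sup_of_nonneg hc]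

theorem abs_smul_of_nonneg {c : ℝ} (hc : 0 ≤ c) (a : E) : |c • a| = c • |a| := by
  simp [abs, smul_sup_of_nonneg hc]

theorem disjoint_smul_left {a b : E} (ha : 0 ≤ a) (hb : 0 ≤ b) (hab : a ⊓ b = 0) {c : ℝ}
    (hc : 0 ≤ c) : (c • a) ⊓ b = 0 := by
  refine le_antisymm ?_ (le_inf (smul_nonneg hc ha) hb)
  calc (c • a) ⊓ b ≤ ((c + 1) • a) ⊓ ((c + 1) • b) := by
        refine inf_le_inf (smul_le_smul_of_nonneg_right (by linarith) ha) ?_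
        rw [add_smul, one_smul]
        exact le_add_of_nonneg_left (smul_nonneg hc hb)
    _ = 0 := by rw [← smul_inf_of_nonneg (by linarith), hab, smul_zero]

variable [HasSolidNorm E]

/-- Every bounded functional on a normed lattice is a difference of positive ones. -/
theorem exists_nonneg_sub_nonneg (h : E →L[ℝ] ℝ) :
    ∃ f₁ f₂ : E →L[ℝ] ℝ, (∀ x, 0 ≤ x → 0 ≤ f₁ x) ∧ (∀ x, 0 ≤ x → 0 ≤ f₂ x) ∧ h = f₁ - f₂ := by
  -- The functional `(x, -x) ↦ h x` on the antidiagonal is extended below `N`. Since `N` vanishes on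
  -- the negative cone, the extension is positive; its two restrictions are `f₁` and `f₂`.
  set N : E × E → ℝ := fun q => ‖h‖ * (‖q.1⁺‖ + ‖q.2⁺‖) with hN
  have hpos : ∀ a b : E, ‖(a + b)⁺‖ ≤ ‖a⁺‖ + ‖b⁺‖ := fun a b =>
    (norm_le_norm_of_nonneg_of_le (posPart_nonneg _) (posPart_add_le a b)).trans (norm_add_le _ _)
  have hle : ∀ a : E, ‖a⁺‖ ≤ ‖a‖ := fun a =>
    norm_le_norm_of_abs_le_abs ((abs_of_nonneg (posPart_nonneg a)).trans_le
      (sup_le (le_abs_self a) (abs_nonneg a)))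
  obtain ⟨F, hF, hFN⟩ := exists_extension_of_le_sublinear
    ⟨LinearMap.ker (LinearMap.fst ℝ E E + LinearMap.snd ℝ E E),
      ((h : E →ₗ[ℝ] ℝ) ∘ₗ LinearMap.fst ℝ E E).domRestrict _⟩ N
    (fun c hc q => by
      simp only [hN, Prod.smul_fst, Prod.smul_snd, posPart_smul_of_nonneg hc.le, norm_smul,
        Real.norm_of_nonneg hc.le]
      ring)
    (fun q r => by
      simp only [hN, Prod.fst_add, Prod.snd_add, ← mul_add]
      refine mul_le_mul_of_nonneg_left ?_ (norm_nonneg h)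
      linarith [hpos q.1 r.1, hpos q.2 r.2])
    (by
      rintro ⟨⟨x, y⟩, hxy⟩
      obtain rfl : y = -x := (neg_eq_of_add_eq_zero_right (by simpa using hxy)).symm
      change h x ≤ ‖h‖ * (‖x⁺‖ + ‖(-x)⁺‖)
      refine (le_abs_self _).trans ((h.le_opNorm x).trans ?_)
      refine mul_le_mul_of_nonneg_left ?_ (norm_nonneg h)
      rw [posPart_neg]
      conv_lhs => rw [← posPart_sub_negPart x]
      exact norm_sub_le _ _)
  have hbd : ∀ q, |F q| ≤ ‖h‖ * (‖q.1‖ + ‖q.2‖) := fun q => by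
    have key : ∀ r : E × E, F r ≤ ‖h‖ * (‖r.1‖ + ‖r.2‖) := fun r =>
      (hFN r).trans (mul_le_mul_of_nonneg_left (add_le_add (hle _) (hle _)) (norm_nonneg h))
    have := key (-q)
    simp only [map_neg, Prod.fst_neg, Prod.snd_neg, norm_neg] at this
    exact abs_le.2 ⟨by linarith, key q⟩
  have hnn : ∀ q : E × E, 0 ≤ q.1 → 0 ≤ q.2 → 0 ≤ F q := fun q h1 h2 => by
    have := hFN (-q)
    simp only [hN, map_neg, Prod.fst_neg, Prod.snd_neg, posPart_neg, negPart_eq_zero.2 h1,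
      negPart_eq_zero.2 h2, norm_zero, add_zero, mul_zero] at this
    linarith
  refine ⟨(F ∘ₗ LinearMap.inl ℝ E E).mkContinuous ‖h‖ fun x => by simpa using hbd (x, 0),
    (F ∘ₗ LinearMap.inr ℝ E E).mkContinuous ‖h‖ fun x => by simpa using hbd (0, x),
    fun x hx => hnn (x, 0) hx le_rfl, fun x hx => hnn (0, x) le_rfl hx, ?_⟩
  ext x
  have hx : F (x, -x) = h x := hF ⟨(x, -x), by simp⟩
  have : F (x, -x) = F (x, 0) - F (0, x) := by rw [← map_sub]; simp
  exact hx.symm.trans this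

/-- For a positive functional `f` and disjoint positive `v k`, each `w k` is normed by a functional
`g k` concentrated on the band of `v k`, with `∑ |g k| ≤ f ∘ |·|`. -/
theorem exists_functionals_of_disjoint {f : E →L[ℝ] ℝ} (hf : ∀ x, 0 ≤ x → 0 ≤ f x)
    {v : ℕ → E} (hv : ∀ k, 0 ≤ v k) (hdis : ∀ i j, i ≠ j → v i ⊓ v j = 0) {w : ℕ → E}
    (hvw : ∀ k, v k ≤ |w k|) :
    ∃ g : ℕ → E →L[ℝ] ℝ, (∀ x (s : Finset ℕ), ∑ k ∈ s, |g k x| ≤ f |x|) ∧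
      ∀ k, f (v k) ≤ g k (w k) := by
  have hmono := ContinuousLinearMap.monotone_of_nonneg hf
  -- A seminorm playing the part of `f` applied to the component of `|x|` in the band of `v k`, with
  -- no band projection needed.
  set p : ℕ → E → ℝ := fun k x => ⨆ t : NNReal, f (|x| ⊓ (t : ℝ) • v k) with hp
  have hbdd : ∀ k x, BddAbove (Set.range fun t : NNReal => f (|x| ⊓ (t : ℝ) • v k)) := fun k x =>
    ⟨f |x|, by rintro _ ⟨t, rfl⟩; exact hmono inf_le_left⟩
  have hle : ∀ k x (t : ℝ), 0 ≤ t → f (|x| ⊓ t • v k) ≤ p k x := fun k x t ht =>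
    le_ciSup (hbdd k x) ⟨t, ht⟩
  have hp_neg : ∀ k x, p k (-x) = p k x := fun k x => by simp [hp]
  have hsum : ∀ x (s : Finset ℕ), ∑ k ∈ s, p k x ≤ f |x| := fun x s => by
    have hlim : Tendsto (fun t : NNReal => ∑ k ∈ s, f (|x| ⊓ (t : ℝ) • v k)) atTop
        (𝓝 (∑ k ∈ s, p k x)) := tendsto_finsetSum _ fun k _ =>
      tendsto_atTop_ciSup (fun t₁ t₂ ht => hmono (inf_le_inf_left _
        (smul_le_smul_of_nonneg_right (NNReal.coe_le_coe.2 ht) (hv k)))) (hbdd k x)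
    refine le_of_tendsto' hlim fun t => ?_
    rw [← map_sum]
    refine hmono (sum_le_of_pairwise_inf_eq_zero
      (fun k => le_inf (abs_nonneg x) (smul_nonneg t.2 (hv k))) (abs_nonneg x)
      (fun k => inf_le_left) fun i j hij => ?_)
    refine le_antisymm ((inf_le_inf inf_le_right inf_le_right).trans ?_)
      (le_inf (le_inf (abs_nonneg x) (smul_nonneg t.2 (hv i)))
        (le_inf (abs_nonneg x) (smul_nonneg t.2 (hv j))))
    rw [← smul_inf_of_nonneg t.coe_nonneg, hdis i j hij, smul_zero]
  have hhom_le : ∀ k (c : ℝ), 0 < c → ∀ x, p k (c • x) ≤ c * p k x := fun k c hc x => by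
    refine ciSup_le fun t => ?_
    have : |c • x| ⊓ (t : ℝ) • v k = c • (|x| ⊓ (c⁻¹ * t) • v k) := by
      rw [smul_inf_of_nonneg hc.le, smul_smul, mul_inv_cancel_left₀ hc.ne',
        abs_smul_of_nonneg hc.le]
    rw [this, map_smul, smul_eq_mul]
    exact mul_le_mul_of_nonneg_left (hle k x _ (mul_nonneg (inv_nonneg.2 hc.le) t.2)) hc.le
  have hhom : ∀ k (c : ℝ), 0 < c → ∀ x, p k (c • x) = c * p k x := fun k c hc x => by
    refine le_antisymm (hhom_le k c hc x) ?_
    have := hhom_le k c⁻¹ (inv_pos.2 hc) (c • x)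
    rwa [inv_smul_smul₀ hc.ne', ← div_eq_inv_mul, le_div_iff₀ hc, mul_comm] at this
  have hadd : ∀ k x y, p k (x + y) ≤ p k x + p k y := fun k x y => by
    refine ciSup_le fun t => ?_
    calc f (|x + y| ⊓ (t : ℝ) • v k) ≤ f (|x| ⊓ (t : ℝ) • v k + |y| ⊓ (t : ℝ) • v k) :=
          hmono ((inf_le_inf_right _ (abs_add_le x y)).trans (inf_add_le_inf_add_inf
            (abs_nonneg x) (abs_nonneg y) (smul_nonneg t.2 (hv k))))
      _ ≤ p k x + p k y := by
          rw [map_add]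
          exact add_le_add (hle k x t t.2) (hle k y t t.2)
  choose g hgw hgp using fun k =>
    exists_linearMap_le_sublinear_apply_eq (hhom k) (hadd k) (w k)
  have habs : ∀ k x, |g k x| ≤ p k x := fun k x => by
    have := hgp k (-x)
    rw [map_neg, hp_neg] at this
    exact abs_le.2 ⟨by linarith, hgp k x⟩
  have hbound : ∀ k x, ‖g k x‖ ≤ ‖f‖ * ‖x‖ := fun k x => by
    refine (habs k x).trans (le_trans (by simpa using hsum x {k}) ?_)
    exact (le_abs_self _).trans ((f.le_opNorm |x|).trans_eq (by rw [norm_abs_eq_norm]))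
  refine ⟨fun k => (g k).mkContinuous ‖f‖ (hbound k), fun x s =>
    (Finset.sum_le_sum fun k _ => habs k x).trans (hsum x s), fun k => ?_⟩
  change f (v k) ≤ g k (w k)
  rw [hgw k]
  have := hle k (w k) 1 zero_le_one
  rwa [one_smul, inf_eq_right.2 (hvw k)] at this

/-- Disjointification: if a bounded set `A` of positive elements contains, for every `u ≥ 0`, some
`a` with `f a ≥ ε` and `f (a ⊓ u) ≤ ε / 4`, then `f ≥ ε / 2` on some disjoint sequence dominated
by a sequence in `A`. -/
theorem exists_disjoint_sequence [CompleteSpace E] {f : E →L[ℝ] ℝ} (hf : ∀ x, 0 ≤ x → 0 ≤ f x)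
    {A : Set E} {M ε : ℝ} (hA0 : ∀ a ∈ A, 0 ≤ a) (hAM : ∀ a ∈ A, ‖a‖ ≤ M) (hε : 0 < ε)
    (hA : ∀ u, 0 ≤ u → ∃ a ∈ A, ε ≤ f a ∧ f (a ⊓ u) ≤ ε / 4) :
    ∃ a v : ℕ → E, (∀ k, a k ∈ A) ∧ (∀ k, 0 ≤ v k) ∧ (∀ k, v k ≤ a k) ∧
      (∀ i j, i ≠ j → v i ⊓ v j = 0) ∧ ∀ k, ε / 2 ≤ f (v k) := by
  have hmono := ContinuousLinearMap.monotone_of_nonneg hf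
  have hM : 0 ≤ M := by
    obtain ⟨a, ha, -⟩ := hA 0 le_rfl
    exact (norm_nonneg a).trans (hAM a ha)
  choose! next hnextA hnext hnextu using hA
  -- `η * M * 2` will bound the norm of `w = ∑ c k • a k`, so that `f w ≤ ε / 4`.
  obtain ⟨η, hη, hηM⟩ : ∃ η : ℝ, 0 < η ∧ ‖f‖ * (η * M * 2) ≤ ε / 4 := by
    refine ⟨ε / (8 * (‖f‖ * M + 1)), by positivity, ?_⟩
    have : 0 < ‖f‖ * M + 1 := by positivity
    rw [show ‖f‖ * (ε / (8 * (‖f‖ * M + 1)) * M * 2) = ε / 4 * ((‖f‖ * M) / (‖f‖ * M + 1)) by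
      field_simp; ring]
    exact mul_le_of_le_one_right (by positivity) ((div_le_one this).2 (by linarith))
  set c : ℕ → ℝ := fun k => η * (1 / 2) ^ k with hc
  have hc0 : ∀ k, 0 < c k := fun k => by positivity
  have hci : ∀ k, 0 ≤ (c k)⁻¹ := fun k => (inv_pos.2 (hc0 k)).le
  -- `S k` is the sum of the earlier choices; `a k` is picked so that `f` is small on its overlap
  -- with a large multiple of `S k`.
  let S : ℕ → E := fun k => Nat.rec 0 (fun k s => s + next ((c k)⁻¹ • s)) k
  set a : ℕ → E := fun k => next ((c k)⁻¹ • S k) with ha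
  have hS_succ : ∀ k, S (k + 1) = S k + a k := fun k => rfl
  have hS0 : ∀ k, 0 ≤ S k := fun k => by
    induction k with
    | zero => exact le_rfl
    | succ k ih =>
      rw [hS_succ]
      exact add_nonneg ih (hA0 _ (hnextA _ (smul_nonneg (hci k) ih)))
  have hu0 : ∀ k, 0 ≤ (c k)⁻¹ • S k := fun k => smul_nonneg (hci k) (hS0 k)
  have haA : ∀ k, a k ∈ A := fun k => hnextA _ (hu0 k)
  have ha0 : ∀ k, 0 ≤ a k := fun k => hA0 _ (haA k)
  have hSmono : Monotone S := monotone_nat_of_le_succ fun k => by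
    rw [hS_succ]
    exact le_add_of_nonneg_right (ha0 k)
  have haS : ∀ m n, m < n → a m ≤ S n := fun m n hmn =>
    (le_add_of_nonneg_left (hS0 m)).trans (hSmono (Nat.succ_le_of_lt hmn))
  have hgeom : HasSum (fun k => c k * M) (η * M * 2) := by
    rw [show (fun k => c k * M) = fun k => η * M * (1 / 2) ^ k from
      funext fun k => mul_right_comm _ _ _]
    exact hasSum_geometric_two.mul_left (η * M)
  have hnorm : ∀ k, ‖c k • a k‖ ≤ c k * M := fun k => by
    rw [norm_smul, Real.norm_of_nonneg (hc0 k).le]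
    exact mul_le_mul_of_nonneg_left (hAM _ (haA k)) (hc0 k).le
  have hsum : Summable fun k => c k • a k := Summable.of_norm_bounded hgeom.summable hnorm
  set w : E := ∑' k, c k • a k with hw
  have hcw : ∀ k, c k • a k ≤ w := fun k =>
    hsum.le_tsum k fun j _ => smul_nonneg (hc0 j).le (ha0 j)
  have hw0 : 0 ≤ w := tsum_nonneg fun k => smul_nonneg (hc0 k).le (ha0 k)
  have hfw : f w ≤ ε / 4 := by
    refine ((le_abs_self _).trans (f.le_opNorm w)).trans (le_trans ?_ hηM)
    exact mul_le_mul_of_nonneg_left (tsum_of_norm_bounded hgeom hnorm) (norm_nonneg f)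
  -- Subtracting `(c k)⁻¹ • S k` separates `v k` from earlier terms, subtracting `w` from later
  -- ones: for `m < n`, `v m` and `v n` lie below multiples of the positive and negative parts of `a
  -- m - c n • a n`.
  set v : ℕ → E := fun k => (a k - (c k)⁻¹ • S k - w)⁺ with hv
  have hdis : ∀ m n, m < n → v m ⊓ v n = 0 := fun m n hmn => by
    refine le_antisymm ?_ (le_inf (posPart_nonneg _) (posPart_nonneg _))
    have h1 : v m ≤ (a m - c n • a n)⁺ := posPart_mono <| by
      refine sub_le_sub ?_ (hcw n)
      exact sub_le_self _ (hu0 m)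
    have h2 : v n ≤ (c n)⁻¹ • (a m - c n • a n)⁻ := by
      rw [← posPart_neg, ← posPart_smul_of_nonneg (hci n)]
      refine posPart_mono ?_
      rw [neg_sub, smul_sub, inv_smul_smul₀ (hc0 n).ne']
      refine (sub_le_self _ hw0).trans (sub_le_sub_left ?_ _)
      exact smul_le_smul_of_nonneg_left (haS m n hmn) (hci n)
    refine (inf_le_inf h1 h2).trans ?_
    rw [inf_comm, disjoint_smul_left (negPart_nonneg _) (posPart_nonneg _) _ (hci n)]
    rw [inf_comm, posPart_inf_negPart_eq_zero]
  refine ⟨a, v, haA, fun k => posPart_nonneg _, fun k => ?_, fun i j hij => ?_, fun k => ?_⟩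
  · exact sup_le ((sub_le_self _ hw0).trans (sub_le_self _ (hu0 k))) (ha0 k)
  · rcases hij.lt_or_gt with h | h
    · exact hdis i j h
    · rw [inf_comm]
      exact hdis j i h
  -- Applying `f` leaves `ε - ε / 4 - ε / 4`.
  · have h1 : a k - a k ⊓ (c k)⁻¹ • S k - w ≤ v k := by
      rw [sub_inf, sub_self, sup_sub]
      exact sup_le ((sub_nonpos.2 hw0).trans (posPart_nonneg _) |> fun h => by simpa using h)
        (le_posPart _)
    have h2 := hmono h1
    rw [map_sub, map_sub] at h2
    have h3 := hnext _ (hu0 k)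
    have h4 := hnextu _ (hu0 k)
    linarith

end NormedLattice

/-! ### The main theorem. -/

theorem mainTheorem1 {E : Type*} [NormedAddCommGroup E] [NormedSpace ℝ E] [CompleteSpace E]
    [Lattice E] [IsOrderedAddMonoid E] [IsOrderedModule ℝ E] [HasSolidNorm E]
    (W : Set E) (hW : IsRelativelyWeaklyCompact W)
    (x : ℕ → E) (hxW : ∀ n, x n ∈ LatticeOrderedAddCommGroup.solidClosure W)
    (hx : UawTendsto x atTop 0) :
    WeakTendsto x atTop 0 := by
  suffices key : ∀ f : E →L[ℝ] ℝ, (∀ y, 0 ≤ y → 0 ≤ f y) →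
      Tendsto (fun n => f |x n|) atTop (𝓝 0) by
    have key' : ∀ f : E →L[ℝ] ℝ, (∀ y, 0 ≤ y → 0 ≤ f y) →
        Tendsto (fun n => f (x n)) atTop (𝓝 0) := fun f hf =>
      squeeze_zero_norm (fun n => abs_apply_le_apply_abs hf (x n)) (key f hf)
    rw [weakTendsto_iff_forall_apply]
    intro h
    obtain ⟨f₁, f₂, h₁, h₂, rfl⟩ := exists_nonneg_sub_nonneg h
    simpa using (key' f₁ h₁).sub (key' f₂ h₂)
  intro f hf
  by_contra hcon
  obtain ⟨ε, hε, hfr⟩ : ∃ ε > 0, ∃ᶠ n in atTop, ε ≤ f |x n| := by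
    simpa [Metric.tendsto_nhds, Filter.Frequently, abs_of_nonneg (hf _ (abs_nonneg _))] using hcon
  obtain ⟨M, hM⟩ := hW.exists_norm_le
  obtain ⟨a, v, haA, hv0, hva, hdis, hfv⟩ := exists_disjoint_sequence hf (A := Set.range (|x ·|))
    (M := M) (by rintro _ ⟨n, rfl⟩; exact abs_nonneg _)
    (by
      rintro _ ⟨n, rfl⟩
      obtain ⟨w, hw, hxw⟩ := hxW n
      exact (norm_abs_eq_norm (x n)).trans_le ((norm_le_norm_of_abs_le_abs hxw).trans (hM w hw)))
    hε fun u hu => by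
      have hlim := weakTendsto_iff_forall_apply.1 (hx u hu) f
      simp only [sub_zero, map_zero] at hlim
      -- The large values of `f |x n|` recur, so one meets the eventual smallness of `f (|x n| ⊓
      -- u)`.
      obtain ⟨n, h1, h2⟩ :=
        (hfr.and_eventually (hlim.eventually (ge_mem_nhds (by positivity : 0 < ε / 4)))).exists
      exact ⟨_, ⟨n, rfl⟩, h1, h2⟩
  have hdom : ∀ k, ∃ w ∈ W, a k ≤ |w| := fun k => by
    obtain ⟨n, hn⟩ := haA k
    obtain ⟨w, hw, hxw⟩ := hxW n
    exact ⟨w, hw, hn ▸ hxw⟩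
  choose w hwW haw using hdom
  obtain ⟨g, hgsum, hgw⟩ := exists_functionals_of_disjoint hf hv0 hdis
    fun k => (hva k).trans (haw k)
  have hlim := hW.tendsto_apply_zero_of_sum_abs_le (C := ‖f‖) (fun y s => (hgsum y s).trans
    ((le_abs_self _).trans ((f.le_opNorm |y|).trans_eq (by rw [norm_abs_eq_norm])))) hwW
  have := ge_of_tendsto' hlim fun k => (hfv k).trans (hgw k)
  linarith
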